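/- **Setting.** Let $\mathbb{M}_d$ be a connected compact two-point homogeneous Riemannian manifold of dimension $d$ (whenever $\mathrm{dist}(x,y)=\mathrm{dist}(x',y')$ some isometry maps $x\mapsto x'$, $y\mapsto y'$), $\nu$ its normalized Riemannian measure, and $\{S_{n,j}: 1\le j\le\Gamma(n,d),\ n\in\mathbb{N}_0\}$ an orthonormal basis of $L^2(\mathbb{M}_d,\nu;\mathbb{C})$ of smooth eigenfunctions of the Laplace–Beltrami operator, $n$ indexing the distinct eigenvalues, and $\Gamma(n,d)\geq 1$ being the dimension of the $n$-th eigenspace. Write $\mathcal{S}$ for the Hilbert–Schmidt operators on $L^2(\mathbb{M}_d,\nu;\mathbb{C})$, identified with their kernels in $L^2(\mathbb{M}_d^2,\nu\otimes\nu;\mathbb{C})$ (so that $\|\cdot\|_{\mathcal S}$ is the $L^2$ norm of the kernel), $\|\cdot\|_{1}$ for the nuclear norm, and $(f\otimes g)(x,y)=f(x)g(y)$. Let $X=\{X_t,\ t\in\mathbb{Z}\}$ be a sequence of random elements of $L^2(\mathbb{M}_d,\nu;\mathbb{R})$ with $E\|X_t\|^2<\infty$, $E[X_t]=0$, and covariance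 operators $\mathcal{R}_\tau=E[X_s\otimes X_{s+\tau}]=E[X_{s+\tau}\otimes X_s]$ not depending on $s\in\mathbb{Z}$. Let $\mathcal{F}_\omega$ be its spectral density operator family, $\mathcal{F}_\omega=\frac1{2\pi}\sum_{\tau\in\mathbb Z}e^{-i\omega\tau}\mathcal{R}_\tau$ in the sense of Fourier series: $\omega\mapsto\mathcal{F}_\omega\in\mathcal{S}$ is $2\pi$-periodic, integrable over $[-\pi,\pi]$, and $\mathcal{R}_\tau=\int_{-\pi}^{\pi}e^{i\omega\tau}\mathcal{F}_\omega\,d\omega$ for all $\tau\in\mathbb{Z}$. **Hypotheses.** 1. ($H_1$, long-range dependence.) There are $l_\alpha,L_\alpha\in(0,1/2)$, exponents $\alpha(n)\in[l_\alpha,L_\alpha]$, and functions $M_n:[-\pi,\pi]\to(0,\infty)$, continuous and slowly varying at $0$ in Zygmund's sense (for each $\delta>0$, $x^{\delta}M_n(x)$ is increasing and $x^{-\delta}M_n(x)$ is decreasing for small $x>0$), such that, with convergence in $\|\cdot\|_{\mathcal{S}}$, $$\mathcal{F}_\omega=\sum_{n\ge0}\frac{M_n(\omega)}{|\omega|^{\alpha(n)}}\sum_{j=1}^{\Gamma(n,d)}S_{n,j}\otimes\overline{S_{n,j}}\quad(\omega\in[-\pi,\pi]\setminus\{0\}),\qquad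 \mathcal{M}_\omega=\sum_{n\ge0}M_n(\omega)\sum_{j=1}^{\Gamma(n,d)}S_{n,j}\otimes\overline{S_{n,j}}\quad(\omega\in[-\pi,\pi]),$$ and $\sum_{\tau\in\mathbb{Z}}\big\|\int_{-\pi}^{\pi}e^{i\omega\tau}\mathcal{M}_\omega\,d\omega\big\|_{1}<\infty$. 2. (Fourth-order cumulants.) $E\|X_t\|^4<\infty$ for all $t$; for all $t_1,t_2,t_3\in\mathbb{Z}$ the kernel $\mathrm{cum}(X_{t_1},X_{t_2},X_{t_3},X_0)$ on $\mathbb{M}_d^4$ is invariant under the isometries of $\mathbb{M}_d$; and $\sum_{t_1,t_2,t_3\in\mathbb{Z}}\|\mathrm{cum}(X_{t_1},X_{t_2},X_{t_3},X_0)\|^2_{L^2(\mathbb{M}_d^4)}<\infty$. 3. $\int_{-\pi}^{\pi}\|\mathcal{M}_\omega\|_{1}^2\,|\omega|^{-2L_\alpha}\,d\omega<\infty$. 4. The weight $W:\mathbb{R}\to[0,\infty)$ is even, of bounded variation, square integrable, vanishes for $|x|\ge1$, and $\int_{\mathbb R} W=1$. The bandwidths satisfy $B_T>0$, $B_T\to0$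 and $TB_T\to\infty$ as $T\to\infty$. **Weighted periodogram operator.** For $T\ge2$ put $\widetilde X^{(T)}_\omega=(2\pi T)^{-1/2}\sum_{t=0}^{T-1}X_te^{-i\omega t}$, $\mathcal{P}^{(T)}_\omega=\widetilde X^{(T)}_\omega\otimes\widetilde X^{(T)}_{-\omega}$, $W^{(T)}(x)=\sum_{j\in\mathbb{Z}}B_T^{-1}W\big((x+2\pi j)/B_T\big)$ and $$\widehat{\mathcal{F}}^{(T)}_\omega=\frac{2\pi}{T}\sum_{s=1}^{T-1}W^{(T)}\Big(\omega-\frac{2\pi s}{T}\Big)\mathcal{P}^{(T)}_{2\pi s/T}.$$ **Conclusion.** All the integrals below exist (as Bochner integrals in $\mathcal{S}$) for $T\ge2$, and, as $T\to\infty$, $$\left\|\int_{-\pi}^{\pi}E\Big[\widehat{\mathcal{F}}^{(T)}_\omega-\int_{-\pi}^{\pi}W(\xi)\,\mathcal{F}_{\omega-B_T\xi}\,d\xi\Big]d\omega\right\|_{\mathcal{S}}=\mathcal{O}\big(T^{-1/2}B_T^{-1/2}\big).$$ -/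

import Mathlib

open Set Filter Topology MeasureTheory Bundle
open scoped Real ENNReal Manifold ContDiff

namespace ManifoldFTS

noncomputable section

/-! ### Geometry: two-point homogeneous spaces, Riemannian measure, Laplace–Beltrami operator -/

/-- A metric space is two-point homogeneous if any two pairs of points at the same distance
are exchanged by a global isometry. -/
def IsTwoPointHomogeneous (M : Type*) [MetricSpace M] : Prop :=
  ∀ x y x' y' : M, dist x y = dist x' y' → ∃ g : M ≃ᵢ M, g x = x' ∧ g y = y'

section Riemannian

variable {d : ℕ} {M : Type*} [MetricSpace M] [ChartedSpace (EuclideanSpace ℝ (Fin d)) M]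
  [RiemannianBundle (fun x : M => TangentSpace (𝓡 d) x)]

/-- The `i`-th coordinate vector field `∂_i`, in the preferred chart at `p`, at the point of the
chart domain with coordinates `u`. -/
def coordVector (p : M) (i : Fin d) (u : EuclideanSpace ℝ (Fin d)) :
    TangentSpace (𝓡 d) ((chartAt (EuclideanSpace ℝ (Fin d)) p).symm u) :=
  mfderiv 𝓘(ℝ, EuclideanSpace ℝ (Fin d)) (𝓡 d)
    (chartAt (EuclideanSpace ℝ (Fin d)) p).symm u (EuclideanSpace.single i (1 : ℝ))

/-- The Gram matrix `g_{ij} = ⟨∂_i, ∂_j⟩` of the Riemannian metric in the preferred chart at `p`,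
as a function of the coordinates `u`. -/
def gramMatrix (p : M) (u : EuclideanSpace ℝ (Fin d)) : Matrix (Fin d) (Fin d) ℝ :=
  fun i j => inner ℝ (coordVector p i u) (coordVector p j u)

/-- The Laplace–Beltrami operator on complex-valued functions,
`Δ f = (det g)^{-1/2} ∑_i ∂_i ((det g)^{1/2} ∑_j g^{ij} ∂_j f)`,
computed at `p` in the preferred chart at `p`. -/
def laplaceBeltrami (f : M → ℂ) (p : M) : ℂ :=
  let e := chartAt (EuclideanSpace ℝ (Fin d)) p
  let vol : EuclideanSpace ℝ (Fin d) → ℝ := fun u => Real.sqrt (gramMatrix p u).det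
  ((vol (e p))⁻¹ : ℝ) • ∑ i : Fin d,
    fderiv ℝ (fun u => vol u • ∑ j : Fin d, ((gramMatrix p u)⁻¹ i j) •
      fderiv ℝ (f ∘ e.symm) u (EuclideanSpace.single j (1 : ℝ))) (e p)
      (EuclideanSpace.single i (1 : ℝ))

variable [MeasurableSpace M]

/-- `ν` is a constant multiple of the Riemannian volume: in every preferred chart it has density
`c (det g)^{1/2}` with respect to Lebesgue measure, with the same constant `c`. A *probability*
measure with this property is the normalized Riemannian measure. -/
def IsRiemannianMeasure (d : ℕ) {M : Type*} [MetricSpace M]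
    [ChartedSpace (EuclideanSpace ℝ (Fin d)) M]
    [RiemannianBundle (fun x : M => TangentSpace (𝓡 d) x)] [MeasurableSpace M]
    (ν : Measure M) : Prop :=
  ∃ c : ℝ≥0∞, ∀ (p : M) (A : Set M), MeasurableSet A →
    A ⊆ (chartAt (EuclideanSpace ℝ (Fin d)) p).source →
    ν A = c * ∫⁻ u in (chartAt (EuclideanSpace ℝ (Fin d)) p) '' A,
      ENNReal.ofReal (Real.sqrt (gramMatrix p u).det)

/-- `S = (S_{n,j})` is an orthonormal basis of `L²(M, ν; ℂ)` made of smooth eigenfunctions of the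
Laplace–Beltrami operator, `Δ S_{n,j} = -λ_n S_{n,j}`, sorted by the distinct eigenvalues:
`S_{n,j}`, `j < Γ n`, spans the `n`-th eigenspace, of dimension `Γ n`. -/
structure IsLaplaceEigenbasis (d : ℕ) {M : Type*} [MetricSpace M]
    [ChartedSpace (EuclideanSpace ℝ (Fin d)) M]
    [RiemannianBundle (fun x : M => TangentSpace (𝓡 d) x)] [MeasurableSpace M]
    {ν : Measure M} {Γ : ℕ → ℕ}
    (S : HilbertBasis (Σ n : ℕ, Fin (Γ n)) ℂ (Lp ℂ 2 ν)) (lam : ℕ → ℝ) : Prop where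
  strictMono : StrictMono lam
  mult_pos : ∀ n, 0 < Γ n
  eigen : ∀ (n : ℕ) (j : Fin (Γ n)), ∃ u : M → ℂ,
    ContMDiff (𝓡 d) 𝓘(ℝ, ℂ) ∞ u ∧ (∀ p, laplaceBeltrami (d := d) u p = -(lam n : ℂ) * u p) ∧
      (S ⟨n, j⟩ : Lp ℂ 2 ν) =ᵐ[ν] u

end Riemannian

/-! ### Kernels of Hilbert–Schmidt operators -/

section Kernels

variable {X Y : Type*} [MeasurableSpace X] [MeasurableSpace Y]

theorem memLp_tensor {μ : Measure X} {ν : Measure Y} [SFinite μ] [SFinite ν]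
    (f : Lp ℂ 2 μ) (g : Lp ℂ 2 ν) :
    MemLp (fun p : X × Y => f p.1 * g p.2) 2 (μ.prod ν) := by
  have hf := Lp.memLp f
  have hg := Lp.memLp g
  have hm : AEStronglyMeasurable (fun p : X × Y => f p.1 * g p.2) (μ.prod ν) :=
    hf.1.comp_fst.mul hg.1.comp_snd
  refine (memLp_two_iff_integrable_sq_norm hm).2 ?_
  have h1 := (memLp_two_iff_integrable_sq_norm hf.1).1 hf
  have h2 := (memLp_two_iff_integrable_sq_norm hg.1).1 hg
  refine (h1.mul_prod h2).congr (Eventually.of_forall fun p => ?_)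
  simp [mul_pow]

/-- The tensor product `(f ⊗ g)(x, y) = f(x) g(y)`. -/
def tensor {μ : Measure X} {ν : Measure Y} [SFinite μ] [SFinite ν]
    (f : Lp ℂ 2 μ) (g : Lp ℂ 2 ν) : Lp ℂ 2 (μ.prod ν) :=
  (memLp_tensor f g).toLp _

/-- The space of Hilbert–Schmidt operators on `L²(X, μ; ℂ)` with the Hilbert–Schmidt norm, an
operator being represented by its kernel in `L²(X × X, μ ⊗ μ; ℂ)`. The kernel `K` stands for the
operator `(K f)(x) = ∫ K(x, y) f(y) dμ(y)`; its Hilbert–Schmidt norm is the `L²` norm of `K`. -/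
abbrev HS (μ : Measure X) : Type _ := Lp ℂ 2 (μ.prod μ)

/-- The nuclear (trace) norm of the operator with kernel `K`: the supremum of
`∑_i |⟨K e_i, f_i⟩|` over finite orthonormal systems `(e_i)`, `(f_i)`; here `⟨K e, f⟩` is
the inner product of `K` with the kernel `f(x) conj(e(y))`. It is `∞` if `K` is not nuclear. -/
def nuclearNorm {μ : Measure X} [SFinite μ] (K : HS μ) : ℝ≥0∞ :=
  ⨆ (k : ℕ) (e : Fin k → Lp ℂ 2 μ) (f : Fin k → Lp ℂ 2 μ)
    (_ : Orthonormal ℂ e) (_ : Orthonormal ℂ f),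
    ∑ i, ‖inner ℂ (tensor (f i) (star (e i))) K‖ₑ

/-- The kernel `K` has, in Hilbert–Schmidt norm, the diagonal expansion
`∑_n a_n ∑_j S_{n,j} ⊗ conj S_{n,j}`. -/
def HasDiagonalExpansion {μ : Measure X} [SFinite μ] {Γ : ℕ → ℕ}
    (S : HilbertBasis (Σ n : ℕ, Fin (Γ n)) ℂ (Lp ℂ 2 μ)) (a : ℕ → ℝ) (K : HS μ) : Prop :=
  HasSum (fun n => (a n : ℂ) • ∑ j : Fin (Γ n), tensor (S ⟨n, j⟩) (star (S ⟨n, j⟩))) K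

/-- A real-valued square integrable function regarded as a complex-valued one. -/
def complexify {μ : Measure X} (f : Lp ℝ 2 μ) : Lp ℂ 2 μ :=
  Complex.ofRealCLM.compLp f

end Kernels

/-! ### Functional time series -/

section Series

variable {M Ω : Type*} [MeasurableSpace M] [MeasurableSpace Ω] {ν : Measure M} [SFinite ν]

/-- The kernel of `E[X_s ⊗ X_t]`. -/
def secondMoment (P : Measure Ω) (X : ℤ → Ω → Lp ℝ 2 ν) (s t : ℤ) : HS ν :=
  ∫ w, tensor (complexify (X s w)) (complexify (X t w)) ∂P

/-- `X` is a zero-mean, second-order stationary sequence in `L²(M, ν; ℝ)` whose covariance operator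
family is `R`: `R_τ = E[X_s ⊗ X_{s+τ}] = E[X_{s+τ} ⊗ X_s]`. Finiteness of `E‖X_t‖²` amounts to
nuclearity of the covariance operators. -/
structure IsStationarySeries (P : Measure Ω) (X : ℤ → Ω → Lp ℝ 2 ν) (R : ℤ → HS ν) : Prop where
  memLp : ∀ t, MemLp (X t) 2 P
  mean_zero : ∀ t, ∫ w, X t w ∂P = 0
  cov : ∀ s τ : ℤ, secondMoment P X s (s + τ) = R τ ∧ secondMoment P X (s + τ) s = R τ

/-- `F` is the (`2π`-periodically extended) spectral density operator family of the covariance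
operator family `R`: `F_θ = (2π)⁻¹ ∑_τ exp(-iθτ) R_τ` as a Fourier series, that is, `F` is
integrable over a period with `R_τ = ∫_{-π}^{π} exp(iθτ) F_θ dθ` for all `τ`. -/
structure IsSpectralDensity (R : ℤ → HS ν) (F : ℝ → HS ν) : Prop where
  periodic : Function.Periodic F (2 * π)
  integrable : IntervalIntegrable F volume (-π) (π : ℝ)
  fourier : ∀ τ : ℤ, R τ = ∫ θ in (-π)..π, Complex.exp (Complex.I * θ * τ) • F θ

/-- `L` is slowly varying at zero in Zygmund's sense: for each `δ > 0`, near `0+`, `x^δ L(x)` is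
increasing and `x^{-δ} L(x)` is decreasing. -/
def IsZygmundSlowlyVaryingAtZero (L : ℝ → ℝ) : Prop :=
  ∀ δ : ℝ, 0 < δ → ∃ ε > 0, MonotoneOn (fun x : ℝ => x ^ δ * L x) (Ioo 0 ε) ∧
    AntitoneOn (fun x : ℝ => x ^ (-δ) * L x) (Ioo 0 ε)

/-- The long-range dependence alternative: the eigenvalues of the spectral density operators `F_θ`
on the Laplace–Beltrami eigenspaces are `f_n(θ) = M_n(θ) |θ|^{-α(n)}`, where `α(n)` are the
eigenvalues of the long-range dependence operator, lying in `[l, L] ⊆ (0, 1/2)`, and `M_n(θ)` are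
those of the regular part, the operator family `Mop`. -/
structure IsLRDAlternative {Γ : ℕ → ℕ}
    (S : HilbertBasis (Σ n : ℕ, Fin (Γ n)) ℂ (Lp ℂ 2 ν))
    (F : ℝ → HS ν) (Mop : ℝ → HS ν) (m : ℕ → ℝ → ℝ) (α : ℕ → ℝ) (l L : ℝ) : Prop where
  l_mem : l ∈ Ioo (0 : ℝ) (1 / 2)
  L_mem : L ∈ Ioo (0 : ℝ) (1 / 2)
  exponent_mem : ∀ n, α n ∈ Icc l L
  regular_pos : ∀ n, ∀ θ ∈ Icc (-π) π, 0 < m n θ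
  regular_continuous : ∀ n, ContinuousOn (m n) (Icc (-π) π)
  regular_slow : ∀ n, IsZygmundSlowlyVaryingAtZero (m n)
  regular_expansion : ∀ θ ∈ Icc (-π) π, HasDiagonalExpansion S (fun n => m n θ) (Mop θ)
  regular_summable :
    ∑' τ : ℤ, nuclearNorm (∫ θ in (-π)..π, Complex.exp (Complex.I * θ * τ) • Mop θ) ≠ ⊤
  spectral_expansion : ∀ θ ∈ Icc (-π) π, θ ≠ 0 →
    HasDiagonalExpansion S (fun n => m n θ * |θ| ^ (-α n)) (F θ)

/-- The kernel `cum(X_{t₁}(x), X_{t₂}(y), X_{t₃}(z), X_{t₄}(v))` of a zero-mean sequence, at the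
point `((x, y), (z, v))`. -/
def cumulantFour (P : Measure Ω) (X : ℤ → Ω → Lp ℝ 2 ν) (t₁ t₂ t₃ t₄ : ℤ)
    (q : (M × M) × (M × M)) : ℂ :=
  (∫ w, tensor (tensor (complexify (X t₁ w)) (complexify (X t₂ w)))
      (tensor (complexify (X t₃ w)) (complexify (X t₄ w))) ∂P :
      Lp ℂ 2 ((ν.prod ν).prod (ν.prod ν))) q
    - secondMoment P X t₁ t₂ (q.1.1, q.1.2) * secondMoment P X t₃ t₄ (q.2.1, q.2.2)
    - secondMoment P X t₁ t₃ (q.1.1, q.2.1) * secondMoment P X t₂ t₄ (q.1.2, q.2.2)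
    - secondMoment P X t₁ t₄ (q.1.1, q.2.2) * secondMoment P X t₂ t₃ (q.1.2, q.2.1)

/-- The fourth-order cumulants exist, their kernels are isotropic (invariant under all isometries of
`M`), and their squared `L²(M⁴)` norms are summable. -/
structure FourthOrderAssumption {M Ω : Type*} [MetricSpace M] [MeasurableSpace M]
    [MeasurableSpace Ω] {ν : Measure M} [SFinite ν]
    (P : Measure Ω) (X : ℤ → Ω → Lp ℝ 2 ν) : Prop where
  memLp : ∀ t, MemLp (X t) 4 P
  isotropic : ∀ (t₁ t₂ t₃ : ℤ) (g : M ≃ᵢ M), ∀ᵐ q ∂((ν.prod ν).prod (ν.prod ν)),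
    cumulantFour P X t₁ t₂ t₃ 0 ((g q.1.1, g q.1.2), (g q.2.1, g q.2.2))
      = cumulantFour P X t₁ t₂ t₃ 0 q
  summable : ∑' t : ℤ × ℤ × ℤ, ∫⁻ q, ‖cumulantFour P X t.1 t.2.1 t.2.2 0 q‖ₑ ^ 2
    ∂((ν.prod ν).prod (ν.prod ν)) ≠ ⊤

/-! ### The weighted periodogram operator -/

/-- The functional discrete Fourier transform
`(2πT)^{-1/2} ∑_{t=0}^{T-1} X_t exp(-iθt)`. -/
def fDFT (X : ℤ → Ω → Lp ℝ 2 ν) (T : ℕ) (θ : ℝ) (w : Ω) : Lp ℂ 2 ν :=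
  (((Real.sqrt (2 * π * T))⁻¹ : ℝ) : ℂ) • ∑ t ∈ Finset.range T,
    Complex.exp (-Complex.I * θ * t) • complexify (X (t : ℤ) w)

/-- The periodogram operator `X̃_θ ⊗ X̃_{-θ}`. -/
def periodogram (X : ℤ → Ω → Lp ℝ 2 ν) (T : ℕ) (θ : ℝ) (w : Ω) : HS ν :=
  tensor (fDFT X T θ w) (fDFT X T (-θ) w)

/-- Conditions on the weight function: nonnegative, even, of bounded variation, vanishing off
`(-1, 1)`, square integrable, of integral one. -/
structure IsWeightFunction (W : ℝ → ℝ) : Prop where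
  nonneg : ∀ x, 0 ≤ W x
  even : ∀ x, W (-x) = W x
  boundedVariation : BoundedVariationOn W univ
  support : ∀ x, 1 ≤ |x| → W x = 0
  memLp : MemLp W 2 volume
  integral_eq_one : ∫ x, W x = 1

/-- The periodized rescaled weight `∑_{j ∈ ℤ} b⁻¹ W((x + 2πj)/b)`. -/
def periodizedWeight (W : ℝ → ℝ) (b x : ℝ) : ℝ :=
  ∑' j : ℤ, b⁻¹ * W ((x + 2 * π * j) / b)

/-- The weighted periodogram operator
`(2π/T) ∑_{s=1}^{T-1} W^{(T)}(θ - 2πs/T) P_{2πs/T}`, with bandwidth `b`. -/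
def weightedPeriodogram (X : ℤ → Ω → Lp ℝ 2 ν) (W : ℝ → ℝ) (b : ℝ) (T : ℕ) (θ : ℝ) (w : Ω) :
    HS ν :=
  (2 * π / T : ℝ) • ∑ s ∈ Finset.Icc 1 (T - 1),
    periodizedWeight W b (θ - 2 * π * s / T) • periodogram X T (2 * π * s / T) w

/-- The kernel-smoothed spectral density operator `∫_{-π}^{π} W(ξ) F_{θ - bξ} dξ`. -/
def smoothedDensity (F : ℝ → HS ν) (W : ℝ → ℝ) (b θ : ℝ) : HS ν :=
  ∫ ξ in (-π)..π, W ξ • F (θ - b * ξ)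

end Series

end

end ManifoldFTS

open ManifoldFTS

/-!
The integrated bias is exactly `-(2π/T) E[P_0]`: the periodized weight has integral one over a
period, orthogonality of characters gives `(2π/T) ∑_{s<T} E[P_{2πs/T}] = R_0`, and smoothing
preserves `∫ F = R_0`, so only the omitted frequency `s = 0` survives.
Moreover `E[P_0] = (2πT)⁻¹ ∫ |D_T|² F` with the Dirichlet kernel `D_T`, and `|D_T| ≤ T`,
`∫ |D_T|² = 2πT` and the Cauchy–Schwarz inequality bound the integrated bias by a constant times
`T^{-1/2}`. Square integrability of `‖F‖` comes from `‖F_θ‖ ≤ π |θ|^{-L} ‖M_θ‖₁`, and the factor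
`B_T^{-1/2}` is eventually at least one.
-/

namespace ManifoldFTS

section Tensor

variable {X Y Ω : Type*} [MeasurableSpace X] [MeasurableSpace Y] [MeasurableSpace Ω]
  {μ : Measure X} {ν : Measure Y}

theorem inner_star_star (f g : Lp ℂ 2 μ) : inner ℂ (star f) (star g) = inner ℂ g f := by
  rw [L2.inner_def, L2.inner_def]
  refine integral_congr_ae ?_
  filter_upwards [Lp.coeFn_star f, Lp.coeFn_star g] with p hf hg
  rw [hf, hg]
  simp [mul_comm]

variable [SFinite μ] [SFinite ν]

theorem tensor_coeFn (f : Lp ℂ 2 μ) (g : Lp ℂ 2 ν) :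
    tensor f g =ᵐ[μ.prod ν] fun p => f p.1 * g p.2 :=
  (memLp_tensor f g).coeFn_toLp

theorem tensor_add_left (f f' : Lp ℂ 2 μ) (g : Lp ℂ 2 ν) :
    tensor (f + f') g = tensor f g + tensor f' g := by
  refine Lp.ext ?_
  filter_upwards [tensor_coeFn (f + f') g, tensor_coeFn f g, tensor_coeFn f' g,
    Lp.coeFn_add (tensor f g) (tensor f' g),
    Measure.quasiMeasurePreserving_fst.ae (Lp.coeFn_add f f')] with p h h₁ h₂ h_add hf
  rw [h, h_add, Pi.add_apply, h₁, h₂, hf, Pi.add_apply, add_mul]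

theorem tensor_add_right (f : Lp ℂ 2 μ) (g g' : Lp ℂ 2 ν) :
    tensor f (g + g') = tensor f g + tensor f g' := by
  refine Lp.ext ?_
  filter_upwards [tensor_coeFn f (g + g'), tensor_coeFn f g, tensor_coeFn f g',
    Lp.coeFn_add (tensor f g) (tensor f g'),
    Measure.quasiMeasurePreserving_snd.ae (Lp.coeFn_add g g')] with p h h₁ h₂ h_add hg
  rw [h, h_add, Pi.add_apply, h₁, h₂, hg, Pi.add_apply, mul_add]

theorem tensor_smul_left (c : ℂ) (f : Lp ℂ 2 μ) (g : Lp ℂ 2 ν) :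
    tensor (c • f) g = c • tensor f g := by
  refine Lp.ext ?_
  filter_upwards [tensor_coeFn (c • f) g, tensor_coeFn f g, Lp.coeFn_smul c (tensor f g),
    Measure.quasiMeasurePreserving_fst.ae (Lp.coeFn_smul c f)] with p h h₁ h_smul hf
  rw [h, h_smul, Pi.smul_apply, h₁, hf, Pi.smul_apply, smul_mul_assoc]

theorem tensor_smul_right (c : ℂ) (f : Lp ℂ 2 μ) (g : Lp ℂ 2 ν) :
    tensor f (c • g) = c • tensor f g := by
  refine Lp.ext ?_
  filter_upwards [tensor_coeFn f (c • g), tensor_coeFn f g, Lp.coeFn_smul c (tensor f g),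
    Measure.quasiMeasurePreserving_snd.ae (Lp.coeFn_smul c g)] with p h h₁ h_smul hg
  rw [h, h_smul, Pi.smul_apply, h₁, hg, Pi.smul_apply, mul_smul_comm]

theorem inner_tensor (f f' : Lp ℂ 2 μ) (g g' : Lp ℂ 2 ν) :
    inner ℂ (tensor f g) (tensor f' g') = inner ℂ f f' * inner ℂ g g' := by
  rw [L2.inner_def, L2.inner_def, L2.inner_def, ← integral_prod_mul]
  refine integral_congr_ae ?_
  filter_upwards [tensor_coeFn f g, tensor_coeFn f' g'] with p h h'
  rw [h, h']
  simp only [RCLike.inner_apply, map_mul]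
  ring

theorem norm_tensor (f : Lp ℂ 2 μ) (g : Lp ℂ 2 ν) : ‖tensor f g‖ = ‖f‖ * ‖g‖ := by
  have h := inner_tensor f f g g
  simp only [inner_self_eq_norm_sq_to_K, ← mul_pow] at h
  norm_cast at h
  exact (sq_eq_sq₀ (norm_nonneg _) (by positivity)).1 (by exact_mod_cast h)

/-- The tensor product of square integrable functions, as a continuous bilinear map. -/
noncomputable def tensorL (μ : Measure X) (ν : Measure Y) [SFinite μ] [SFinite ν] :
    Lp ℂ 2 μ →L[ℂ] Lp ℂ 2 ν →L[ℂ] Lp ℂ 2 (μ.prod ν) :=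
  LinearMap.mkContinuous₂ (LinearMap.mk₂ ℂ tensor tensor_add_left tensor_smul_left
    tensor_add_right tensor_smul_right) 1 fun f g => by simp [norm_tensor]

theorem tensorL_apply (f : Lp ℂ 2 μ) (g : Lp ℂ 2 ν) : tensorL μ ν f g = tensor f g := rfl

theorem integrable_tensor {P : Measure Ω} {U : Ω → Lp ℂ 2 μ} {V : Ω → Lp ℂ 2 ν}
    (hU : MemLp U 2 P) (hV : MemLp V 2 P) : Integrable (fun w => tensor (U w) (V w)) P :=
  (hU.norm.integrable_mul hV.norm).mono'
    ((tensorL μ ν).aestronglyMeasurable_comp₂ hU.aestronglyMeasurable hV.aestronglyMeasurable)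
    (Eventually.of_forall fun w => (norm_tensor (U w) (V w)).le)

theorem orthonormal_tensor_star {ι : Type*} {v : ι → Lp ℂ 2 μ} (hv : Orthonormal ℂ v) :
    Orthonormal ℂ (fun i => tensor (v i) (star (v i))) := by
  classical
  rw [orthonormal_iff_ite]
  intro i j
  rw [inner_tensor, inner_star_star, orthonormal_iff_ite.1 hv, orthonormal_iff_ite.1 hv]
  simp only [mul_ite, mul_one, mul_zero, eq_comm (a := j)]
  split_ifs <;> rfl

end Tensor

section Diagonal

variable {X : Type*} [MeasurableSpace X] {μ : Measure X} [SFinite μ]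

theorem sum_enorm_inner_le_nuclearNorm {ι : Type*} {e f : ι → Lp ℂ 2 μ} (he : Orthonormal ℂ e)
    (hf : Orthonormal ℂ f) (K : HS μ) (s : Finset ι) :
    ∑ i ∈ s, ‖inner ℂ (tensor (f i) (star (e i))) K‖ₑ ≤ nuclearNorm K := by
  have h_inj : Function.Injective fun k => (s.equivFin.symm k : ι) :=
    Subtype.val_injective.comp s.equivFin.symm.injective
  calc ∑ i ∈ s, ‖inner ℂ (tensor (f i) (star (e i))) K‖ₑ
      = ∑ k, ‖inner ℂ (tensor (f (s.equivFin.symm k)) (star (e (s.equivFin.symm k)))) K‖ₑ := by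
        rw [← Finset.sum_coe_sort, ← s.equivFin.symm.sum_comp]
    _ ≤ nuclearNorm K :=
        le_iSup_of_le s.card <| le_iSup_of_le _ <| le_iSup_of_le _ <|
          le_iSup_of_le (he.comp _ h_inj) <| le_iSup_of_le (hf.comp _ h_inj) le_rfl

variable {Γ : ℕ → ℕ} {S : HilbertBasis (Σ n : ℕ, Fin (Γ n)) ℂ (Lp ℂ 2 μ)}

theorem HasDiagonalExpansion.inner_eq {a : ℕ → ℝ} {K : HS μ} (h : HasDiagonalExpansion S a K)
    (i : Σ n : ℕ, Fin (Γ n)) : inner ℂ (tensor (S i) (star (S i))) K = (a i.1 : ℂ) := by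
  obtain ⟨n, j⟩ := i
  have h_orth := orthonormal_iff_ite.1 (orthonormal_tensor_star S.orthonormal)
  refine (h.mapL (innerSL ℂ (tensor (S ⟨n, j⟩) (star (S ⟨n, j⟩))))).unique ?_
  convert hasSum_single n fun k hk => ?_ using 1
  · simp [h_orth]
  · have h_ne : ∀ j' : Fin (Γ k), (⟨n, j⟩ : Σ n, Fin (Γ n)) ≠ ⟨k, j'⟩ :=
      fun j' h_eq => hk (congrArg Sigma.fst h_eq).symm
    simp [h_orth, h_ne]

theorem HasDiagonalExpansion.enorm_le {a a' : ℕ → ℝ} {K K' : HS μ} {C : ℝ≥0∞}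
    (h : HasDiagonalExpansion S a K) (h' : HasDiagonalExpansion S a' K')
    (hC : ∀ n, ‖a' n‖ₑ ≤ C * ‖a n‖ₑ) : ‖K'‖ₑ ≤ C * nuclearNorm K := by
  have h_real : ∀ x : ℝ, ‖(x : ℂ)‖ₑ = ‖x‖ₑ := fun x => by
    rw [← ofReal_norm, Complex.norm_real, ofReal_norm]
  have h_unit : ∀ i, ‖tensor (S i) (star (S i))‖ₑ = 1 := fun i => by
    rw [← ofReal_norm, (orthonormal_tensor_star S.orthonormal).1 i, ENNReal.ofReal_one]
  have h_term : ∀ n, ‖(a' n : ℂ) • ∑ j : Fin (Γ n), tensor (S ⟨n, j⟩) (star (S ⟨n, j⟩))‖ₑ ≤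
      ∑ _j : Fin (Γ n), C * ‖a n‖ₑ := fun n => by
    calc _ ≤ ‖a' n‖ₑ * ∑ j : Fin (Γ n), ‖tensor (S ⟨n, j⟩) (star (S ⟨n, j⟩))‖ₑ := by
          rw [enorm_smul, h_real]
          gcongr
          exact enorm_sum_le _ _
      _ ≤ _ := by
          simp only [h_unit, Finset.mul_sum, mul_one]
          exact Finset.sum_le_sum fun _ _ => hC n
  refine le_of_tendsto ((continuous_enorm.tendsto K').comp h') (Eventually.of_forall fun s => ?_)
  calc ‖∑ n ∈ s, (a' n : ℂ) • ∑ j : Fin (Γ n), tensor (S ⟨n, j⟩) (star (S ⟨n, j⟩))‖ₑ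
      ≤ ∑ n ∈ s, ∑ _j : Fin (Γ n), C * ‖a n‖ₑ :=
        (enorm_sum_le _ _).trans (Finset.sum_le_sum fun n _ => h_term n)
    _ = C * ∑ i ∈ s.sigma fun n => (Finset.univ : Finset (Fin (Γ n))),
          ‖inner ℂ (tensor (S i) (star (S i))) K‖ₑ := by
        rw [Finset.sum_sigma, Finset.mul_sum]
        simp only [h.inner_eq, h_real, Finset.mul_sum]
    _ ≤ C * nuclearNorm K := by
        gcongr
        exact sum_enorm_inner_le_nuclearNorm S.orthonormal S.orthonormal K _

end Diagonal

section LongRangeDependence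

variable {M : Type*} [MeasurableSpace M] {ν : Measure M} [SFinite ν] {Γ : ℕ → ℕ}
  {S : HilbertBasis (Σ n : ℕ, Fin (Γ n)) ℂ (Lp ℂ 2 ν)} {F Mop : ℝ → HS ν} {m : ℕ → ℝ → ℝ}
  {α : ℕ → ℝ} {l L : ℝ}

theorem rpow_neg_le_mul_rpow_neg {x c r s : ℝ} (hx : 0 < x) (hxc : x ≤ c) (hc : 1 ≤ c)
    (hrs : r ≤ s) (hsr : s ≤ r + 1) : x ^ (-r) ≤ c * x ^ (-s) := by
  have h_factor : x ^ (-r) = x ^ (s - r) * x ^ (-s) := by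
    rw [← Real.rpow_add hx]
    ring_nf
  have h_power : x ^ (s - r) ≤ c :=
    calc x ^ (s - r) ≤ c ^ (s - r) := Real.rpow_le_rpow hx.le hxc (by linarith)
      _ ≤ c := Real.rpow_le_self_of_one_le hc (by linarith)
  rw [h_factor]
  gcongr

theorem IsLRDAlternative.enorm_le (h : IsLRDAlternative S F Mop m α l L) {θ : ℝ}
    (hθ : θ ∈ Icc (-π) π) (hθ0 : θ ≠ 0) :
    ‖F θ‖ₑ ≤ ENNReal.ofReal (π * |θ| ^ (-L)) * nuclearNorm (Mop θ) := by
  refine (h.regular_expansion θ hθ).enorm_le (h.spectral_expansion θ hθ hθ0) fun n => ?_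
  obtain ⟨hαl, hαL⟩ := h.exponent_mem n
  have h_weight : |θ| ^ (-α n) ≤ π * |θ| ^ (-L) :=
    rpow_neg_le_mul_rpow_neg (abs_pos.2 hθ0) (abs_le.2 hθ) (by linarith [Real.pi_gt_three]) hαL
      (by linarith [h.l_mem.1, h.L_mem.2])
  rw [enorm_mul, mul_comm, Real.enorm_of_nonneg (by positivity)]
  gcongr

theorem IsLRDAlternative.intervalIntegrable_sq_norm (h : IsLRDAlternative S F Mop m α l L)
    (hF : IntervalIntegrable F volume (-π) π)
    (hreg : ∫⁻ θ in Icc (-π) π,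
      nuclearNorm (Mop θ) ^ 2 * ENNReal.ofReal (|θ| ^ (-2 * L)) ≠ ⊤) :
    IntervalIntegrable (fun θ => ‖F θ‖ ^ 2) volume (-π) π := by
  rw [intervalIntegrable_iff_integrableOn_Icc_of_le (by linarith [Real.pi_pos])] at hF ⊢
  refine ⟨hF.aestronglyMeasurable.norm.pow 2, ?_⟩
  have h_sq : ∀ θ ∈ Icc (-π) π, θ ≠ 0 → ‖‖F θ‖ ^ 2‖ₑ ≤ ENNReal.ofReal (π ^ 2) *
      (nuclearNorm (Mop θ) ^ 2 * ENNReal.ofReal (|θ| ^ (-2 * L))) := fun θ hθ hθ0 => by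
    have h_exp : (|θ| ^ (-L)) ^ 2 = |θ| ^ (-2 * L) := by
      rw [← Real.rpow_mul_natCast (abs_nonneg θ)]
      push_cast
      ring_nf
    rw [enorm_pow, enorm_norm, mul_left_comm, ← ENNReal.ofReal_mul (by positivity), ← h_exp,
      ← mul_pow, ENNReal.ofReal_pow (by positivity), mul_comm, ← mul_pow]
    exact pow_le_pow_left' (h.enorm_le hθ hθ0) 2
  calc ∫⁻ θ in Icc (-π) π, ‖‖F θ‖ ^ 2‖ₑ
      ≤ ∫⁻ θ in Icc (-π) π, ENNReal.ofReal (π ^ 2) *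
          (nuclearNorm (Mop θ) ^ 2 * ENNReal.ofReal (|θ| ^ (-2 * L))) := by
        refine lintegral_mono_ae ?_
        filter_upwards [ae_restrict_of_ae (Measure.ae_ne volume 0),
          ae_restrict_mem measurableSet_Icc] with θ hθ0 hθ using h_sq θ hθ hθ0
    _ < ⊤ := by
        rw [lintegral_const_mul' _ _ ENNReal.ofReal_ne_top]
        exact ENNReal.mul_lt_top ENNReal.ofReal_lt_top hreg.lt_top

end LongRangeDependence

section LagSum

variable {A : Type*} [AddCommMonoid A]

/-- The Fejér-type sum `∑_{t,u < T} G(u - t)` of a function of the lag, in which the lag `τ` has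
multiplicity `(T - |τ|)⁺`. It is kept as a double sum, the form in which second moments of
finite trigonometric sums arise. -/
def lagSum (T : ℕ) (G : ℤ → A) : A :=
  ∑ t ∈ Finset.range T, ∑ u ∈ Finset.range T, G ((u : ℤ) - t)

theorem sum_lagSum {ι : Type*} (s : Finset ι) (T : ℕ) (G : ι → ℤ → A) :
    ∑ i ∈ s, lagSum T (G i) = lagSum T fun τ => ∑ i ∈ s, G i τ := by
  simp only [lagSum]
  rw [Finset.sum_comm]
  exact Finset.sum_congr rfl fun t _ => Finset.sum_comm

theorem lagSum_smul_const {𝕜 : Type*} [Semiring 𝕜] [Module 𝕜 A] (T : ℕ) (c : ℤ → 𝕜) (a : A) :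
    lagSum T (fun τ => c τ • a) = lagSum T c • a := by
  simp only [lagSum, Finset.sum_smul]

theorem lagSum_eq_nsmul {T : ℕ} {G : ℤ → A} (hG : ∀ τ : ℤ, τ ≠ 0 → |τ| < T → G τ = 0) :
    lagSum T G = T • G 0 := by
  have h_row : ∀ t ∈ Finset.range T, ∑ u ∈ Finset.range T, G ((u : ℤ) - t) = G 0 := fun t ht => by
    rw [Finset.sum_eq_single_of_mem t ht, sub_self]
    intro u hu hut
    rw [Finset.mem_range] at ht hu
    exact hG _ (by omega) (by rw [abs_lt]; omega)
  rw [lagSum, Finset.sum_congr rfl h_row, Finset.sum_const, Finset.card_range]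

theorem intervalIntegral_lagSum {E : Type*} [NormedAddCommGroup E] [NormedSpace ℝ E] {a b : ℝ}
    {g : ℤ → ℝ → E} (hg : ∀ τ, IntervalIntegrable (g τ) volume a b) (T : ℕ) :
    ∫ θ in a..b, lagSum T (fun τ => g τ θ) = lagSum T fun τ => ∫ θ in a..b, g τ θ := by
  have h_row : ∀ t : ℕ, IntervalIntegrable (fun θ => ∑ u ∈ Finset.range T, g ((u : ℤ) - t) θ)
      volume a b := fun t => by
    simpa only [Finset.sum_fn] using
      IntervalIntegrable.sum (Finset.range T) fun u _ => hg ((u : ℤ) - t)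
  simp only [lagSum]
  rw [intervalIntegral.integral_finsetSum fun t _ => h_row t]
  exact Finset.sum_congr rfl fun t _ => intervalIntegral.integral_finsetSum fun u _ => hg _

end LagSum

section DirichletKernel

/-- The one-sided Dirichlet kernel `∑_{t < T} exp(iθt)`; its squared modulus is `T` times the
Fejér kernel. -/
noncomputable def dirichletKernel (T : ℕ) (θ : ℝ) : ℂ :=
  ∑ t ∈ Finset.range T, Complex.exp (Complex.I * θ * t)

theorem continuous_dirichletKernel (T : ℕ) : Continuous (dirichletKernel T) := by
  unfold dirichletKernel
  fun_prop

theorem norm_dirichletKernel_le (T : ℕ) (θ : ℝ) : ‖dirichletKernel T θ‖ ≤ T := by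
  have h_unit : ∀ t : ℕ, ‖Complex.exp (Complex.I * θ * t)‖ = 1 := fun t => by
    simp [Complex.norm_exp]
  simpa [h_unit, dirichletKernel] using
    norm_sum_le (Finset.range T) fun t : ℕ => Complex.exp (Complex.I * θ * t)

theorem ofReal_sq_norm_dirichletKernel (T : ℕ) (θ : ℝ) : ((‖dirichletKernel T θ‖ ^ 2 : ℝ) : ℂ) =
    lagSum T fun τ => Complex.exp (Complex.I * θ * τ) := by
  rw [← Complex.normSq_eq_norm_sq, Complex.normSq_eq_conj_mul_self]
  simp only [dirichletKernel, lagSum, map_sum, Finset.sum_mul_sum, ← Complex.exp_conj,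
    ← Complex.exp_add]
  refine Finset.sum_congr rfl fun t _ => Finset.sum_congr rfl fun u _ => ?_
  congr 1
  simp only [map_mul, Complex.conj_I, Complex.conj_ofReal, neg_mul, map_natCast, Int.cast_sub,
    Int.cast_natCast]
  ring

theorem integral_exp_int (n : ℤ) :
    ∫ θ in (-π)..π, Complex.exp (Complex.I * θ * n) = if n = 0 then (2 * π : ℂ) else 0 := by
  split_ifs with hn
  · simp only [hn, Int.cast_zero, mul_zero, Complex.exp_zero, intervalIntegral.integral_const,
      sub_neg_eq_add, Complex.real_smul, Complex.ofReal_add, mul_one]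
    ring
  · have h_ne : Complex.I * n ≠ 0 := mul_ne_zero Complex.I_ne_zero (by exact_mod_cast hn)
    have h_period : Complex.exp (Complex.I * n * π) = Complex.exp (Complex.I * n * (-π : ℝ)) := by
      rw [Complex.exp_eq_exp_iff_exists_int]
      exact ⟨n, by push_cast; ring⟩
    simp only [mul_right_comm Complex.I _ (n : ℂ)]
    rw [integral_exp_mul_complex h_ne, h_period, sub_self, zero_div]

theorem integral_sq_norm_dirichletKernel (T : ℕ) :
    ∫ θ in (-π)..π, ‖dirichletKernel T θ‖ ^ 2 = 2 * π * T := by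
  rw [← Complex.ofReal_inj, ← intervalIntegral.integral_ofReal]
  simp only [ofReal_sq_norm_dirichletKernel]
  rw [intervalIntegral_lagSum fun τ => Continuous.intervalIntegrable (by fun_prop) _ _,
    lagSum_eq_nsmul fun τ hτ _ => by rw [integral_exp_int, if_neg hτ], integral_exp_int]
  simp [mul_comm]

end DirichletKernel

section FourierCoefficients

theorem integral_mul_le_sqrt_mul_sqrt {X : Type*} [MeasurableSpace X] {μ : Measure X}
    {f g : X → ℝ} (hf0 : ∀ x, 0 ≤ f x) (hg0 : ∀ x, 0 ≤ g x) (hf : MemLp f 2 μ)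
    (hg : MemLp g 2 μ) : ∫ x, f x * g x ∂μ ≤ √(∫ x, f x ^ 2 ∂μ) * √(∫ x, g x ^ 2 ∂μ) := by
  simp only [Real.sqrt_eq_rpow, ← Real.rpow_two]
  exact integral_mul_le_Lp_mul_Lq_of_nonneg Real.HolderConjugate.two_two
    (Eventually.of_forall hf0) (Eventually.of_forall hg0) (by simpa using hf) (by simpa using hg)

theorem norm_lagSum_fourierCoeff_le {E : Type*} [NormedAddCommGroup E] [NormedSpace ℂ E]
    {F : ℝ → E} (hF : IntervalIntegrable F volume (-π) π)
    (hF2 : IntervalIntegrable (fun θ => ‖F θ‖ ^ 2) volume (-π) π) (T : ℕ) :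
    ‖lagSum T fun τ => ∫ θ in (-π)..π, Complex.exp (Complex.I * θ * τ) • F θ‖ ≤
      T * (√(2 * π * T) * √(∫ θ in (-π)..π, ‖F θ‖ ^ 2)) := by
  have hpi : -π ≤ π := by linarith [Real.pi_pos]
  have h_sum : (lagSum T fun τ => ∫ θ in (-π)..π, Complex.exp (Complex.I * θ * τ) • F θ) =
      ∫ θ in (-π)..π, ((‖dirichletKernel T θ‖ ^ 2 : ℝ) : ℂ) • F θ := by
    simp only [ofReal_sq_norm_dirichletKernel, ← lagSum_smul_const]
    rw [intervalIntegral_lagSum fun τ =>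
      hF.continuousOn_smul (Continuous.continuousOn (by fun_prop))]
  have hD : MemLp (fun θ => ‖dirichletKernel T θ‖) 2 (volume.restrict (Ioc (-π) π)) :=
    MemLp.of_bound (continuous_dirichletKernel T).norm.aestronglyMeasurable T
      (Eventually.of_forall fun θ => by simpa using norm_dirichletKernel_le T θ)
  have hF_memLp : MemLp (fun θ => ‖F θ‖) 2 (volume.restrict (Ioc (-π) π)) := by
    rw [intervalIntegrable_iff_integrableOn_Ioc_of_le hpi] at hF hF2
    exact (memLp_two_iff_integrable_sq hF.aestronglyMeasurable.norm).2 hF2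
  rw [h_sum]
  calc ‖∫ θ in (-π)..π, ((‖dirichletKernel T θ‖ ^ 2 : ℝ) : ℂ) • F θ‖
      ≤ ∫ θ in (-π)..π, T * (‖dirichletKernel T θ‖ * ‖F θ‖) := by
        refine intervalIntegral.norm_integral_le_of_norm_le hpi
          (Eventually.of_forall fun θ _ => ?_) ?_
        · rw [norm_smul, Complex.norm_real, norm_pow, norm_norm, sq, mul_assoc]
          gcongr
          exact norm_dirichletKernel_le T θ
        · exact (hF.norm.continuousOn_mul
            (continuous_dirichletKernel T).norm.continuousOn).const_mul _
    _ ≤ T * (√(2 * π * T) * √(∫ θ in (-π)..π, ‖F θ‖ ^ 2)) := by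
        rw [intervalIntegral.integral_const_mul, ← integral_sq_norm_dirichletKernel]
        simp only [intervalIntegral.integral_of_le hpi]
        gcongr
        exact integral_mul_le_sqrt_mul_sqrt (fun _ => norm_nonneg _) (fun _ => norm_nonneg _)
          hD hF_memLp

end FourierCoefficients

section ExpectedPeriodogram

variable {M Ω : Type*} [MeasurableSpace M] [MeasurableSpace Ω] {ν : Measure M} [SFinite ν]
  {P : Measure Ω} {X : ℤ → Ω → Lp ℝ 2 ν} {R : ℤ → HS ν}

omit [SFinite ν] in
theorem memLp_complexify {f : Ω → Lp ℝ 2 ν} (hf : MemLp f 2 P) :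
    MemLp (fun w => complexify (f w)) 2 P :=
  (Complex.ofRealCLM.compLpL 2 ν).comp_memLp' hf

omit [SFinite ν] in
theorem memLp_fDFT (hX : ∀ t, MemLp (X t) 2 P) (T : ℕ) (θ : ℝ) :
    MemLp (fun w => fDFT X T θ w) 2 P := by
  have h_sum : MemLp (fun w => ∑ t ∈ Finset.range T,
      Complex.exp (-Complex.I * θ * t) • complexify (X t w)) 2 P :=
    memLp_finsetSum _ fun t _ => (memLp_complexify (hX t)).const_smul (Complex.exp _)
  exact h_sum.const_smul (((√(2 * π * T))⁻¹ : ℝ) : ℂ)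

theorem integrable_periodogram (hX : ∀ t, MemLp (X t) 2 P) (T : ℕ) (θ : ℝ) :
    Integrable (fun w => periodogram X T θ w) P :=
  integrable_tensor (memLp_fDFT hX T θ) (memLp_fDFT hX T (-θ))

theorem integrable_weightedPeriodogram (hX : ∀ t, MemLp (X t) 2 P) (W : ℝ → ℝ) (b : ℝ) (T : ℕ)
    (θ : ℝ) : Integrable (fun w => weightedPeriodogram X W b T θ w) P :=
  (integrable_finsetSum _ fun _ _ => (integrable_periodogram hX T _).fun_smul _).fun_smul _

theorem integral_weightedPeriodogram (hX : ∀ t, MemLp (X t) 2 P) (W : ℝ → ℝ) (b : ℝ) (T : ℕ)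
    (θ : ℝ) : ∫ w, weightedPeriodogram X W b T θ w ∂P =
      (2 * π / T : ℝ) • ∑ s ∈ Finset.Icc 1 (T - 1),
        periodizedWeight W b (θ - 2 * π * s / T) • ∫ w, periodogram X T (2 * π * s / T) w ∂P := by
  simp only [weightedPeriodogram]
  rw [integral_smul, integral_finsetSum _ fun _ _ => (integrable_periodogram hX T _).fun_smul _]
  simp only [integral_smul]

omit [MeasurableSpace Ω] in
theorem periodogram_eq_sum (T : ℕ) (θ : ℝ) (w : Ω) :
    periodogram X T θ w = (2 * π * T)⁻¹ • ∑ t ∈ Finset.range T, ∑ u ∈ Finset.range T,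
      Complex.exp (Complex.I * θ * ((u - t : ℤ) : ℂ)) •
        tensor (complexify (X t w)) (complexify (X u w)) := by
  have h_sqrt : ((√(2 * π * T))⁻¹ : ℝ) * (√(2 * π * T))⁻¹ = (2 * π * T)⁻¹ := by
    rw [← mul_inv, Real.mul_self_sqrt (by positivity)]
  have h_exp : ∀ t u : ℕ,
      Complex.exp (-Complex.I * θ * t) * Complex.exp (-Complex.I * (-θ : ℝ) * u) =
        Complex.exp (Complex.I * θ * ((u - t : ℤ) : ℂ)) := fun t u => by
    rw [← Complex.exp_add]
    push_cast
    ring_nf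
  rw [← h_sqrt, ← algebraMap_smul ℂ, Complex.coe_algebraMap, Complex.ofReal_mul, mul_smul]
  simp only [periodogram, fDFT, ← tensorL_apply, map_smul, map_sum, _root_.sum_apply,
    _root_.smul_apply, ← h_exp, mul_smul, Finset.smul_sum]
  rw [Finset.sum_comm]
  refine Finset.sum_congr rfl fun t _ => Finset.sum_congr rfl fun u _ => ?_
  simp only [smul_smul]
  congr 1
  ring

theorem integral_periodogram (hX : IsStationarySeries P X R) (T : ℕ) (θ : ℝ) :
    ∫ w, periodogram X T θ w ∂P =
      (2 * π * T)⁻¹ • lagSum T fun τ => Complex.exp (Complex.I * θ * τ) • R τ := by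
  have h_int : ∀ t u : ℕ, Integrable (fun w => Complex.exp (Complex.I * θ * ((u - t : ℤ) : ℂ)) •
      tensor (complexify (X t w)) (complexify (X u w))) P := fun t u =>
    (integrable_tensor (memLp_complexify (hX.memLp t)) (memLp_complexify (hX.memLp u))).fun_smul _
  have h_cov : ∀ t u : ℕ, ∫ w, tensor (complexify (X t w)) (complexify (X u w)) ∂P = R (u - t) :=
    fun t u => by simpa only [secondMoment, add_sub_cancel] using (hX.cov t (u - t)).1
  simp only [periodogram_eq_sum]
  rw [integral_smul, integral_finsetSum _ fun t _ => integrable_finsetSum _ fun u _ => h_int t u,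
    lagSum]
  congr 1
  refine Finset.sum_congr rfl fun t _ => ?_
  rw [integral_finsetSum _ fun u _ => h_int t u]
  simp only [integral_smul, h_cov]

theorem sum_exp_fourierFrequency {T : ℕ} (hT : T ≠ 0) (τ : ℤ) :
    ∑ s ∈ Finset.range T, Complex.exp (Complex.I * ((2 * π * s / T : ℝ) : ℂ) * τ) =
      if (T : ℤ) ∣ τ then (T : ℂ) else 0 := by
  have hζ := Complex.isPrimitiveRoot_exp T hT
  set ζ := Complex.exp (2 * π * Complex.I / T) with hζ_def
  have h_pow : ∀ s : ℕ, Complex.exp (Complex.I * ((2 * π * s / T : ℝ) : ℂ) * τ) = (ζ ^ τ) ^ s :=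
    fun s => by
      rw [hζ_def, ← Complex.exp_int_mul, ← Complex.exp_nat_mul]
      push_cast
      ring_nf
  simp only [h_pow]
  split_ifs with hτ
  · simp [(hζ.zpow_eq_one_iff_dvd τ).2 hτ]
  · have h_root : (ζ ^ τ) ^ T = 1 := by
      rw [← zpow_natCast, zpow_comm, zpow_natCast, hζ.pow_eq_one, one_zpow]
    rw [geom_sum_eq (mt (hζ.zpow_eq_one_iff_dvd τ).1 hτ), h_root, sub_self, zero_div]

theorem sum_integral_periodogram (hX : IsStationarySeries P X R) {T : ℕ} (hT : T ≠ 0) :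
    (2 * π / T : ℝ) • ∑ s ∈ Finset.range T, ∫ w, periodogram X T (2 * π * s / T) w ∂P = R 0 := by
  have h_lag : (lagSum T fun τ => ∑ s ∈ Finset.range T,
      Complex.exp (Complex.I * ((2 * π * s / T : ℝ) : ℂ) * τ) • R τ) = ((T : ℝ) * T) • R 0 := by
    simp only [← Finset.sum_smul, sum_exp_fourierFrequency hT]
    rw [lagSum_eq_nsmul fun τ hτ hτT => by
      rw [if_neg fun h => hτ (Int.eq_zero_of_abs_lt_dvd h hτT), zero_smul]]
    rw [if_pos (dvd_zero _), ← Nat.cast_smul_eq_nsmul ℝ, mul_smul]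
    norm_cast
  simp only [integral_periodogram hX]
  rw [← Finset.smul_sum, sum_lagSum, h_lag, smul_smul, smul_smul]
  convert one_smul ℝ (R 0) using 2
  field_simp

end ExpectedPeriodogram

section Periodization

variable {E : Type*} [NormedAddCommGroup E] [NormedSpace ℝ E]

theorem hasSum_intervalIntegral_translates {g : ℝ → E} (hg : Integrable g) {p : ℝ} (hp : 0 < p)
    (t : ℝ) : HasSum (fun j : ℤ => ∫ x in t..t + p, g (x + p * j)) (∫ x, g x) := by
  have h_cells := hasSum_integral_iUnion (fun _ => measurableSet_Ioc)
    (pairwise_disjoint_Ioc_add_zsmul t p) hg.integrableOn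
  rw [iUnion_Ioc_add_zsmul hp, setIntegral_univ] at h_cells
  refine h_cells.congr_fun fun j => ?_
  rw [intervalIntegral.integral_comp_add_right,
    ← intervalIntegral.integral_of_le (by simp [add_smul, hp.le])]
  congr 1 <;> simp only [zsmul_eq_mul, Int.cast_add, Int.cast_one] <;> ring

theorem intervalIntegral_tsum_translates {g : ℝ → E} (hg : Integrable g) {p : ℝ} (hp : 0 < p)
    (t : ℝ) : ∫ x in t..t + p, ∑' j : ℤ, g (x + p * j) = ∫ x, g x := by
  have h_le : t ≤ t + p := by linarith
  have h_sum := hasSum_intervalIntegral_translates hg hp t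
  have h_norm := (hasSum_intervalIntegral_translates hg.norm hp t).summable
  simp only [intervalIntegral.integral_of_le h_le] at h_sum h_norm ⊢
  exact (hasSum_integral_of_summable_integral_norm
    (fun j : ℤ => (hg.comp_add_right (p * j)).integrableOn) h_norm).unique h_sum

variable {W : ℝ → ℝ} {b : ℝ}

theorem integral_periodizedWeight (hW : Integrable W) (hb : 0 < b) (c : ℝ) :
    ∫ θ in (-π)..π, periodizedWeight W b (θ - c) = ∫ x, W x := by
  have h_scaled : Integrable fun x => b⁻¹ * W (x / b) := (hW.comp_div hb.ne').const_mul _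
  calc ∫ θ in (-π)..π, periodizedWeight W b (θ - c)
      = ∫ x in (-π - c)..(-π - c) + 2 * π, periodizedWeight W b x := by
        rw [intervalIntegral.integral_comp_sub_right]
        ring_nf
    _ = ∫ x, b⁻¹ * W (x / b) := intervalIntegral_tsum_translates h_scaled Real.two_pi_pos _
    _ = ∫ x, W x := by
        rw [integral_const_mul, Measure.integral_comp_div, abs_of_pos hb, smul_eq_mul,
          inv_mul_cancel_left₀ hb.ne']

theorem intervalIntegrable_periodizedWeight (hW : Integrable W) (hW1 : ∫ x, W x = 1) (hb : 0 < b)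
    (c : ℝ) : IntervalIntegrable (fun θ => periodizedWeight W b (θ - c)) volume (-π) π :=
  intervalIntegral.intervalIntegrable_of_integral_ne_zero <| by
    rw [integral_periodizedWeight hW hb, hW1]
    exact one_ne_zero

end Periodization

section TranslateAverage

variable {E A : Type*} [NormedAddCommGroup E] [MeasurableSpace A] {μ : Measure A} {F : ℝ → E}
  {p t : ℝ} {w φ : A → ℝ}

theorem aestronglyMeasurable_of_periodic (hF : Function.Periodic F p) (hp : 0 < p)
    (hFi : IntervalIntegrable F volume t (t + p)) : AEStronglyMeasurable F volume := by
  rw [← Measure.restrict_univ (μ := volume), ← iUnion_Ioc_add_zsmul hp t,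
    aestronglyMeasurable_iUnion_iff]
  exact fun n => (hF.intervalIntegrable hp.ne' hFi _ _).1.aestronglyMeasurable

variable [NormedSpace ℝ E]

theorem intervalIntegral_comp_sub_of_periodic (hF : Function.Periodic F p) (c : ℝ) :
    ∫ x in t..t + p, F (x - c) = ∫ x in t..t + p, F x := by
  rw [intervalIntegral.integral_comp_sub_right, add_sub_right_comm,
    hF.intervalIntegral_add_eq (t - c) t]

variable [SFinite μ]

theorem integrable_smul_translate (hF : Function.Periodic F p) (hp : 0 < p)
    (hFi : IntervalIntegrable F volume t (t + p)) (hw : Integrable w μ) (hφ : Measurable φ) :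
    Integrable (fun q : A × ℝ => w q.1 • F (q.2 - φ q.1))
      (μ.prod (volume.restrict (Ioc t (t + p)))) := by
  have ht : t ≤ t + p := by linarith
  have h_shear : MeasurePreserving (fun q : A × ℝ => (q.1, q.2 - φ q.1))
      (μ.prod volume) (μ.prod volume) :=
    (MeasurePreserving.id μ).skew_product (g := fun a x => x - φ a) (by fun_prop)
      (Eventually.of_forall fun a => (measurePreserving_sub_right volume (φ a)).map_eq)
  have h_meas : AEStronglyMeasurable (fun q : A × ℝ => w q.1 • F (q.2 - φ q.1))
      (μ.prod (volume.restrict (Ioc t (t + p)))) :=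
    AEStronglyMeasurable.mono_ac (Measure.AbsolutelyContinuous.rfl.prod
        Measure.restrict_le_self.absolutelyContinuous)
      (hw.aestronglyMeasurable.comp_fst.smul
        ((aestronglyMeasurable_of_periodic hF hp hFi).comp_snd.comp_measurePreserving h_shear))
  have h_translate : ∀ c, IntegrableOn (fun x => F (x - c)) (Ioc t (t + p)) := fun c =>
    (intervalIntegrable_iff_integrableOn_Ioc_of_le ht).1 <| by
      simpa using (hF.intervalIntegrable hp.ne' hFi (t - c) (t + p - c)).comp_sub_right c
  have h_per : Function.Periodic (fun x => ‖F x‖) p := fun x => by simp only [hF x]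
  have h_norm : ∀ a, ∫ x in Ioc t (t + p), ‖w a • F (x - φ a)‖ =
      ‖w a‖ * ∫ x in t..t + p, ‖F x‖ := fun a => by
    simp only [norm_smul, ← intervalIntegral.integral_of_le ht, intervalIntegral.integral_const_mul]
    rw [intervalIntegral_comp_sub_of_periodic h_per]
  rw [integrable_prod_iff h_meas]
  refine ⟨Eventually.of_forall fun a => (h_translate (φ a)).smul (w a), ?_⟩
  simp only [h_norm]
  exact hw.norm.mul_const _

theorem intervalIntegrable_translateAverage (hF : Function.Periodic F p) (hp : 0 < p)
    (hFi : IntervalIntegrable F volume t (t + p)) (hw : Integrable w μ) (hφ : Measurable φ) :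
    IntervalIntegrable (fun x => ∫ a, w a • F (x - φ a) ∂μ) volume t (t + p) := by
  rw [intervalIntegrable_iff_integrableOn_Ioc_of_le (by linarith)]
  exact (integrable_smul_translate hF hp hFi hw hφ).integral_prod_right

theorem integral_translateAverage [CompleteSpace E] (hF : Function.Periodic F p) (hp : 0 < p)
    (hFi : IntervalIntegrable F volume t (t + p)) (hw : Integrable w μ) (hφ : Measurable φ) :
    ∫ x in t..t + p, ∫ a, w a • F (x - φ a) ∂μ = (∫ a, w a ∂μ) • ∫ x in t..t + p, F x := by
  have ht : t ≤ t + p := by linarith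
  calc ∫ x in t..t + p, ∫ a, w a • F (x - φ a) ∂μ
      = ∫ a, (∫ x in t..t + p, w a • F (x - φ a)) ∂μ := by
        simp only [intervalIntegral.integral_of_le ht]
        exact (integral_integral_swap (f := fun a x => w a • F (x - φ a))
          (integrable_smul_translate hF hp hFi hw hφ)).symm
    _ = ∫ a, (w a • ∫ x in t..t + p, F x) ∂μ := by
        simp only [intervalIntegral.integral_smul, intervalIntegral_comp_sub_of_periodic hF]
    _ = (∫ a, w a ∂μ) • ∫ x in t..t + p, F x := integral_smul_const _ _

end TranslateAverage

section Smoothing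

theorem intervalIntegrable_smul_comp_sub_mul {E : Type*} [NormedAddCommGroup E] [NormedSpace ℝ E]
    {F : ℝ → E} {w : ℝ → ℝ} {b C x y : ℝ} (hF : ∀ x y, IntervalIntegrable F volume x y)
    (hw : AEStronglyMeasurable w) (hC : ∀ x, ‖w x‖ ≤ C) (hb : b ≠ 0) (θ : ℝ) :
    IntervalIntegrable (fun ξ => w ξ • F (θ - b * ξ)) volume x y := by
  have h_reflect : IntervalIntegrable (fun u => F (θ - u)) volume (b * x) (b * y) := by
    simpa using (hF (θ - b * x) (θ - b * y)).comp_sub_left θ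
  have h_dilate : IntervalIntegrable (fun ξ => F (θ - b * ξ)) volume x y := by
    simpa only [mul_div_cancel_left₀ _ hb] using h_reflect.comp_mul_left (c := b)
  rw [intervalIntegrable_iff] at h_dilate ⊢
  exact h_dilate.bdd_smul _ hw.restrict (Eventually.of_forall hC)

variable {M : Type*} [MeasurableSpace M] {ν : Measure M} {R : ℤ → HS ν}
  {F : ℝ → HS ν} {W : ℝ → ℝ}

theorem IsSpectralDensity.intervalIntegrable (hF : IsSpectralDensity R F) (x y : ℝ) :
    IntervalIntegrable F volume x y :=
  hF.periodic.intervalIntegrable (t := -π) Real.two_pi_pos.ne'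
    (by convert hF.integrable using 1; ring) x y

theorem intervalIntegrable_smoothedDensity (hF : IsSpectralDensity R F) (hW : Integrable W)
    (b : ℝ) : IntervalIntegrable (fun θ => smoothedDensity F W b θ) volume (-π) π := by
  have h := intervalIntegrable_translateAverage hF.periodic Real.two_pi_pos
    (hF.intervalIntegrable (-π) _) (hW.restrict (s := Ioc (-π) π)) (measurable_const_mul b)
  rw [show -π + 2 * π = π by ring] at h
  simpa only [smoothedDensity, intervalIntegral.integral_of_le (neg_le_self Real.pi_nonneg)] using h

theorem integral_smoothedDensity (hF : IsSpectralDensity R F) (hW : Integrable W) (b : ℝ) :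
    ∫ θ in (-π)..π, smoothedDensity F W b θ = (∫ ξ in (-π)..π, W ξ) • R 0 := by
  have h := integral_translateAverage hF.periodic Real.two_pi_pos
    (hF.intervalIntegrable (-π) _) (hW.restrict (s := Ioc (-π) π)) (measurable_const_mul b)
  have h_cov : ∫ θ in (-π)..π, F θ = R 0 := by simp [hF.fourier 0]
  rw [show -π + 2 * π = π by ring, h_cov] at h
  simpa only [smoothedDensity, intervalIntegral.integral_of_le (neg_le_self Real.pi_nonneg)] using h

end Smoothing

section Weight

variable {W : ℝ → ℝ}

theorem IsWeightFunction.support_subset (hW : IsWeightFunction W) :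
    Function.support W ⊆ Ioc (-π) π := by
  intro x hx
  have h_abs : |x| < π :=
    (lt_of_not_ge fun h => hx (hW.support x h)).trans (by linarith [Real.pi_gt_three])
  exact ⟨(abs_lt.1 h_abs).1, (abs_lt.1 h_abs).2.le⟩

theorem IsWeightFunction.integrable (hW : IsWeightFunction W) : Integrable W :=
  (integrableOn_iff_integrable_of_support_subset hW.support_subset).1 <|
    (hW.memLp.restrict _).integrable one_le_two

theorem IsWeightFunction.norm_le (hW : IsWeightFunction W) (x : ℝ) :
    ‖W x‖ ≤ (eVariationOn W univ).toReal := by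
  have h := hW.boundedVariation.dist_le (mem_univ x) (mem_univ (1 : ℝ))
  rwa [hW.support 1 (by simp), dist_zero_right] at h

end Weight

section Bias

variable {M Ω : Type*} [MeasurableSpace M] [MeasurableSpace Ω] {ν : Measure M} [SFinite ν]
  {P : Measure Ω} {X : ℤ → Ω → Lp ℝ 2 ν} {R : ℤ → HS ν} {F : ℝ → HS ν} {W : ℝ → ℝ} {b : ℝ}

theorem intervalIntegrable_periodizedWeight_smul {E : Type*} [NormedAddCommGroup E]
    [NormedSpace ℝ E] (hW : Integrable W) (hW1 : ∫ x, W x = 1) (hb : 0 < b) (c : ℝ) (v : E) :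
    IntervalIntegrable (fun θ => periodizedWeight W b (θ - c) • v) volume (-π) π :=
  intervalIntegrable_iff.2
    ((intervalIntegrable_iff.1 (intervalIntegrable_periodizedWeight hW hW1 hb c)).smul_const v)

theorem intervalIntegrable_mean_weightedPeriodogram (hX : ∀ t, MemLp (X t) 2 P)
    (hW : Integrable W) (hW1 : ∫ x, W x = 1) (hb : 0 < b) (T : ℕ) :
    IntervalIntegrable (fun θ => ∫ w, weightedPeriodogram X W b T θ w ∂P) volume (-π) π := by
  simp only [integral_weightedPeriodogram hX]
  refine IntervalIntegrable.smul ?_ (2 * π / T : ℝ)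
  simpa only [Finset.sum_fn] using IntervalIntegrable.sum (Finset.Icc 1 (T - 1)) fun s _ =>
    intervalIntegrable_periodizedWeight_smul hW hW1 hb (2 * π * s / T)
      (∫ w, periodogram X T (2 * π * s / T) w ∂P)

theorem integral_mean_weightedPeriodogram (hX : ∀ t, MemLp (X t) 2 P) (hW : Integrable W)
    (hW1 : ∫ x, W x = 1) (hb : 0 < b) (T : ℕ) :
    ∫ θ in (-π)..π, ∫ w, weightedPeriodogram X W b T θ w ∂P =
      (2 * π / T : ℝ) • ∑ s ∈ Finset.Icc 1 (T - 1),
        ∫ w, periodogram X T (2 * π * s / T) w ∂P := by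
  simp only [integral_weightedPeriodogram hX]
  rw [intervalIntegral.integral_smul, intervalIntegral.integral_finsetSum fun s _ =>
    intervalIntegrable_periodizedWeight_smul hW hW1 hb _ _]
  simp only [intervalIntegral.integral_smul_const, integral_periodizedWeight hW hb, hW1, one_smul]

variable [IsProbabilityMeasure P]

theorem integral_weightedPeriodogram_sub (hX : ∀ t, MemLp (X t) 2 P) (W : ℝ → ℝ) (b : ℝ) (T : ℕ)
    (θ : ℝ) (K : HS ν) : ∫ w, (weightedPeriodogram X W b T θ w - K) ∂P =
      (∫ w, weightedPeriodogram X W b T θ w ∂P) - K := by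
  rw [integral_sub (integrable_weightedPeriodogram hX W b T θ) (integrable_const _),
    integral_const, probReal_univ, one_smul]

theorem intervalIntegrable_bias (hX : ∀ t, MemLp (X t) 2 P) (hF : IsSpectralDensity R F)
    (hW : Integrable W) (hW1 : ∫ x, W x = 1) (hb : 0 < b) (T : ℕ) :
    IntervalIntegrable
      (fun θ => ∫ w, (weightedPeriodogram X W b T θ w - smoothedDensity F W b θ) ∂P)
      volume (-π) π := by
  simp only [integral_weightedPeriodogram_sub hX]
  exact (intervalIntegrable_mean_weightedPeriodogram hX hW hW1 hb T).sub
    (intervalIntegrable_smoothedDensity hF hW b)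

theorem integral_bias (hX : IsStationarySeries P X R) (hF : IsSpectralDensity R F)
    (hW : Integrable W) (hWs : Function.support W ⊆ Ioc (-π) π) (hW1 : ∫ x, W x = 1) (hb : 0 < b)
    {T : ℕ} (hT : T ≠ 0) :
    ∫ θ in (-π)..π, ∫ w, (weightedPeriodogram X W b T θ w - smoothedDensity F W b θ) ∂P =
      -((2 * π / T : ℝ) • ∫ w, periodogram X T 0 w ∂P) := by
  have h_smooth : ∫ θ in (-π)..π, smoothedDensity F W b θ = R 0 := by
    rw [integral_smoothedDensity hF hW,
      intervalIntegral.integral_eq_integral_of_support_subset hWs, hW1, one_smul]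
  have h_range : Finset.range T = insert 0 (Finset.Icc 1 (T - 1)) := by
    ext s
    simp only [Finset.mem_range, Finset.mem_insert, Finset.mem_Icc]
    omega
  have h_cov := sum_integral_periodogram hX hT
  rw [h_range, Finset.sum_insert (by simp), smul_add] at h_cov
  simp only [integral_weightedPeriodogram_sub hX.memLp]
  rw [intervalIntegral.integral_sub
      (intervalIntegrable_mean_weightedPeriodogram hX.memLp hW hW1 hb T)
      (intervalIntegrable_smoothedDensity hF hW b),
    integral_mean_weightedPeriodogram hX.memLp hW hW1 hb, h_smooth, ← h_cov]
  simp

omit [IsProbabilityMeasure P] in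
theorem norm_integral_periodogram_zero_le (hX : IsStationarySeries P X R)
    (hF : IsSpectralDensity R F) (hF2 : IntervalIntegrable (fun θ => ‖F θ‖ ^ 2) volume (-π) π)
    (T : ℕ) : ‖∫ w, periodogram X T 0 w ∂P‖ ≤
      (2 * π * T)⁻¹ * (T * (√(2 * π * T) * √(∫ θ in (-π)..π, ‖F θ‖ ^ 2))) := by
  have h_mean : ∫ w, periodogram X T 0 w ∂P = (2 * π * T : ℝ)⁻¹ • lagSum T R := by
    simpa only [Complex.ofReal_zero, mul_zero, zero_mul, Complex.exp_zero, one_smul] using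
      integral_periodogram hX T 0
  have h_lag : ‖lagSum T R‖ ≤ T * (√(2 * π * T) * √(∫ θ in (-π)..π, ‖F θ‖ ^ 2)) := by
    rw [funext hF.fourier]
    exact norm_lagSum_fourierCoeff_le hF.integrable hF2 T
  rw [h_mean, norm_smul, Real.norm_of_nonneg (by positivity)]
  gcongr

theorem norm_integral_bias_le (hX : IsStationarySeries P X R) (hF : IsSpectralDensity R F)
    (hF2 : IntervalIntegrable (fun θ => ‖F θ‖ ^ 2) volume (-π) π) (hW : Integrable W)
    (hWs : Function.support W ⊆ Ioc (-π) π) (hW1 : ∫ x, W x = 1) (hb : 0 < b)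
    {T : ℕ} (hT : T ≠ 0) :
    ‖∫ θ in (-π)..π, ∫ w, (weightedPeriodogram X W b T θ w - smoothedDensity F W b θ) ∂P‖ ≤
      √(2 * π * ∫ θ in (-π)..π, ‖F θ‖ ^ 2) * (T : ℝ) ^ (-(1 / 2) : ℝ) := by
  have hT_pos : (0 : ℝ) < T := by positivity
  have h_inv_sqrt : (T : ℝ) ^ (-(1 / 2) : ℝ) = √T / T := by
    rw [Real.rpow_neg hT_pos.le, ← Real.sqrt_eq_rpow, Real.sqrt_div_self]
  rw [integral_bias hX hF hW hWs hW1 hb hT, norm_neg, norm_smul,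
    Real.norm_of_nonneg (by positivity), h_inv_sqrt]
  calc 2 * π / T * ‖∫ w, periodogram X T 0 w ∂P‖
      ≤ 2 * π / T * ((2 * π * T)⁻¹ *
          (T * (√(2 * π * T) * √(∫ θ in (-π)..π, ‖F θ‖ ^ 2)))) := by
        gcongr
        exact norm_integral_periodogram_zero_le hX hF hF2 T
    _ = √(2 * π * ∫ θ in (-π)..π, ‖F θ‖ ^ 2) * (√T / T) := by
        rw [Real.sqrt_mul Real.two_pi_pos.le, Real.sqrt_mul Real.two_pi_pos.le]
        field_simp

end Bias

theorem isBigO_mul_rpow_of_tendsto_zero {ι : Type*} {l : Filter ι} {B : ι → ℝ}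
    (hB : Tendsto B l (𝓝[>] 0)) {r : ℝ} (hr : r ≤ 0) (f : ι → ℝ) :
    f =O[l] fun i => f i * B i ^ r := by
  refine Asymptotics.IsBigO.of_bound 1 ?_
  filter_upwards [hB.eventually (Ioo_mem_nhdsGT one_pos)] with i hi
  have h_one : 1 ≤ B i ^ r := Real.one_le_rpow_of_pos_of_le_one_of_nonpos hi.1 hi.2.le hr
  rw [one_mul, norm_mul]
  exact le_mul_of_one_le_right (norm_nonneg _) (h_one.trans (le_abs_self _))

end ManifoldFTS

theorem corollary4p1_general {M Ω : Type*} [MeasurableSpace M] [MeasurableSpace Ω]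
    {ν : Measure M} [SFinite ν] {P : Measure Ω} [IsProbabilityMeasure P]
    {X : ℤ → Ω → Lp ℝ 2 ν} {R : ℤ → HS ν} (hX : IsStationarySeries P X R)
    {F : ℝ → HS ν} (hF : IsSpectralDensity R F)
    (hF2 : IntervalIntegrable (fun θ => ‖F θ‖ ^ 2) volume (-π) π)
    {W : ℝ → ℝ} (hW : Integrable W) {C : ℝ} (hWC : ∀ x, ‖W x‖ ≤ C)
    (hWs : Function.support W ⊆ Ioc (-π) π) (hW1 : ∫ x, W x = 1)
    {B : ℕ → ℝ} (hB : ∀ T, 0 < B T) :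
    (∀ T : ℕ, 2 ≤ T →
      (∀ θ, Integrable (fun w => weightedPeriodogram X W (B T) T θ w) P) ∧
      (∀ θ, IntervalIntegrable (fun ξ => W ξ • F (θ - B T * ξ)) volume (-π) π) ∧
      IntervalIntegrable
        (fun θ => ∫ w, (weightedPeriodogram X W (B T) T θ w - smoothedDensity F W (B T) θ) ∂P)
        volume (-π) π) ∧
    (fun T : ℕ => ‖∫ θ in (-π)..π, ∫ w,
        (weightedPeriodogram X W (B T) T θ w - smoothedDensity F W (B T) θ) ∂P‖)
      =O[atTop] (fun T : ℕ => (T : ℝ) ^ (-(1 / 2) : ℝ)) := by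
  refine ⟨fun T _ => ⟨integrable_weightedPeriodogram hX.memLp W (B T) T,
    intervalIntegrable_smul_comp_sub_mul hF.intervalIntegrable hW.aestronglyMeasurable hWC
      (hB T).ne',
    intervalIntegrable_bias hX.memLp hF hW hW1 (hB T) T⟩, ?_⟩
  refine Asymptotics.IsBigO.of_bound √(2 * π * ∫ θ in (-π)..π, ‖F θ‖ ^ 2) ?_
  filter_upwards [eventually_ne_atTop 0] with T hT
  rw [norm_norm, Real.norm_of_nonneg (by positivity)]
  exact norm_integral_bias_le hX hF hF2 hW hWs hW1 (hB T) hT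

theorem corollary4p1
    -- the manifold, its normalized Riemannian measure and the Laplace–Beltrami eigenbasis
    {d : ℕ} {M : Type*} [MetricSpace M] [CompactSpace M] [ConnectedSpace M]
    [ChartedSpace (EuclideanSpace ℝ (Fin d)) M] [IsManifold (𝓡 d) ∞ M]
    [RiemannianBundle (fun x : M => TangentSpace (𝓡 d) x)]
    [IsContMDiffRiemannianBundle (𝓡 d) ∞ (EuclideanSpace ℝ (Fin d))
      (fun x : M => TangentSpace (𝓡 d) x)]
    [IsRiemannianManifold (𝓡 d) M] (hM : IsTwoPointHomogeneous M)
    [MeasurableSpace M] [BorelSpace M]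
    (ν : Measure M) [IsProbabilityMeasure ν] (hν : IsRiemannianMeasure d ν)
    {Γ : ℕ → ℕ} (S : HilbertBasis (Σ n : ℕ, Fin (Γ n)) ℂ (Lp ℂ 2 ν)) (lam : ℕ → ℝ)
    (hS : IsLaplaceEigenbasis d S lam)
    -- the stationary series and its spectral density operator family
    {Ω : Type*} [MeasurableSpace Ω] (P : Measure Ω) [IsProbabilityMeasure P]
    (X : ℤ → Ω → Lp ℝ 2 ν) (R : ℤ → HS ν) (hX : IsStationarySeries P X R)
    (F : ℝ → HS ν) (hF : IsSpectralDensity R F)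
    -- the long-range dependence alternative
    (Mop : ℝ → HS ν) (m : ℕ → ℝ → ℝ) (α : ℕ → ℝ) (l L : ℝ)
    (hLRD : IsLRDAlternative S F Mop m α l L)
    -- the fourth-order cumulant assumption and the condition on the regular part
    (hcum : FourthOrderAssumption P X)
    (hreg : ∫⁻ θ in Icc (-π) π,
      nuclearNorm (Mop θ) ^ 2 * ENNReal.ofReal (|θ| ^ (-2 * L)) ≠ ⊤)
    -- the weight function and the bandwidth
    (W : ℝ → ℝ) (hW : IsWeightFunction W)
    (B : ℕ → ℝ) (hBpos : ∀ T, 0 < B T) (hB0 : Tendsto B atTop (𝓝 0))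
    (hBT : Tendsto (fun T : ℕ => B T * T) atTop atTop) :
    -- the integrals in the claim exist
    (∀ T : ℕ, 2 ≤ T →
      (∀ θ, Integrable (fun w => weightedPeriodogram X W (B T) T θ w) P) ∧
      (∀ θ, IntervalIntegrable (fun ξ => W ξ • F (θ - B T * ξ)) volume (-π) π) ∧
      IntervalIntegrable
        (fun θ => ∫ w, (weightedPeriodogram X W (B T) T θ w - smoothedDensity F W (B T) θ) ∂P)
        volume (-π) π) ∧
    -- the rate
    (fun T : ℕ => ‖∫ θ in (-π)..π, ∫ w,
        (weightedPeriodogram X W (B T) T θ w - smoothedDensity F W (B T) θ) ∂P‖)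
      =O[atTop] (fun T : ℕ => (T : ℝ) ^ (-(1 / 2) : ℝ) * B T ^ (-(1 / 2) : ℝ)) := by
  have h := corollary4p1_general hX hF (hLRD.intervalIntegrable_sq_norm hF.integrable hreg)
    hW.integrable hW.norm_le hW.support_subset hW.integral_eq_one hBpos
  exact ⟨h.1, h.2.trans <| isBigO_mul_rpow_of_tendsto_zero
    (tendsto_nhdsWithin_iff.2 ⟨hB0, Eventually.of_forall hBpos⟩) (by norm_num) _⟩
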